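/- For an odd prime $q$ put $q^{\ast} = (-1)^{(q-1)/2} q$. An integer $a$ is called a biquadratic residue modulo a prime $p$ if $p\nmid a$ and $a \equiv x^4 \pmod p$ for some integer $x$. Let $\epsilon > 0$. There is a number $p_0(\epsilon)$, depending only on $\epsilon$, such that for every prime $p \equiv 1 \pmod 4$ with $p > p_0(\epsilon)$, \[ \#\{\text{odd primes } q < p^{\frac12+\epsilon} : q^{\ast} \text{ is a biquadratic residue modulo } p\} > p^{\epsilon/50}. \] If moreover $p \equiv 1 \pmod 8$, then also \[ \#\{\text{primes } q < p^{\frac12+\epsilon} : q \text{ is a biquadratic residue modulo } p\} > p^{\epsilon/50}. \] -/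

import Mathlib

/-- The integer `a` is a biquadratic (fourth power) residue modulo `m`: it is coprime to `m`
and congruent to a fourth power modulo `m`. -/
def IsBiquadraticResidue (a : ℤ) (m : ℕ) : Prop :=
  IsCoprime a (m : ℤ) ∧ ∃ x : ℤ, x ^ 4 ≡ a [ZMOD (m : ℤ)]

/-- For an odd natural number `q`, the signed number `q* = (-1)^((q-1)/2) q`.
(The natural-number subtraction and division are exact for odd `q`.) -/
def qStar (q : ℕ) : ℤ := (-1) ^ ((q - 1) / 2) * (q : ℤ)

/-! The source of residues is a quartic polynomial. Let `χ` be a quartic character modulo `p` with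
Jacobi sum `J`, so `J J̄ = p`. If an odd prime `q ≠ p` divides `Im (J (x ± i)⁴)`, then in
characteristic `q` the element `J (x ± i)⁴` equals its conjugate. As `g(χ)⁴ = J² p`, the Gauss sum
is then a fourth root of unity times an explicit element of the image of `ℤ[i]`. Its `q`-th power
can be computed directly, and comparison with `g(χ)^q = χ(q)^(-q) g(χ^q)` gives `χ(q*) = 1`
(`quarticChar_qStar_eq_one`, `exists_quarticForm_biquadraticResidue`).

Now put `t = p^(ε/50)` and evaluate the form at `U ≈ t⁵` points of size about `U²`. The values stay
below `p^(1/2+ε)`, so each of their odd prime factors is `p` or one of the primes to be counted.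
Roots modulo prime powers are simple enough that, if `T` is the set of these primes, the product of
the values is at most `8^U (U!)⁴ F^(4|T|)`, with `F` their maximum
(`prod_le_of_primeFactors_subset`). The product is also at least `(p^(1/2) · 512 U⁶)^U`. The
factorials cancel, leaving `U ≤ (4 + 8ε)|T|`, which is impossible if `|T| ≤ t + 1`. -/

/-! ### Gauss sums of quartic characters and Frobenius. -/

theorem MulChar.isQuadratic_sq {F R : Type*} [Field F] [CommRing R] [IsDomain R]
    {χ : MulChar F R} (hχ : χ ^ 4 = 1) : (χ ^ 2).IsQuadratic := by
  intro x
  rcases eq_or_ne x 0 with rfl | hx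
  · left
    exact MulChar.map_zero _
  · right
    have h : (χ ^ 2) x ^ 2 = 1 := by
      rw [← MulChar.pow_apply' _ two_ne_zero, ← pow_mul, hχ]
      exact MulChar.one_apply hx.isUnit
    exact sq_eq_one_iff.mp h

/-- For a quartic character, `g(χ)⁴ = J(χ, χ)² #F`. -/
theorem gaussSum_pow_four {F R : Type*} [Field F] [Fintype F] [CommRing R] [IsDomain R]
    {χ : MulChar F R} (h4 : χ ^ 4 = 1) (h2 : χ ^ 2 ≠ 1) {ψ : AddChar F R} (hψ : ψ.IsPrimitive) :
    gaussSum χ ψ ^ 4 = jacobiSum χ χ ^ 2 * Fintype.card F := by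
  have hχχ : χ * χ = χ ^ 2 := (pow_two χ).symm
  have h := jacobiSum_mul_nontrivial (χ := χ) (φ := χ) (hχχ ▸ h2) ψ
  have hs := gaussSum_sq h2 (MulChar.isQuadratic_sq h4) hψ
  have hneg : (χ ^ 2) (-1) = 1 := by
    rw [MulChar.pow_apply' _ two_ne_zero, ← map_pow]
    simp
  rw [hneg, one_mul] at hs
  rw [hχχ] at h
  linear_combination (-(gaussSum χ ψ) ^ 2 - gaussSum (χ ^ 2) ψ * jacobiSum χ χ) * h
    + jacobiSum χ χ ^ 2 * hs

/-- A Frobenius computation with the Gauss sum of a quartic character `χ` in characteristic `q`: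
if `J(χ, χ)` times the fourth power of `A` is invariant under conjugation, then `χ` is trivial
at `(-1)^((q-1)/2) q`. The conjugates of `J(χ, χ)` and `A` are called `J'` and `A'`. -/
theorem quarticChar_qStar_eq_one {p q : ℕ} [Fact p.Prime] [Fact q.Prime] (hpq : p ≠ q)
    {K : Type*} [Field K] [CharP K q] {χ : MulChar (ZMod p) K} (h4 : χ ^ 4 = 1) (h2 : χ ^ 2 ≠ 1)
    {ψ : AddChar (ZMod p) K} (hψ : ψ.IsPrimitive) {J' A A' : K} (hA : A ≠ 0) (hA' : A' ≠ 0)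
    (hJJ' : jacobiSum χ χ * J' = p) (hJA : jacobiSum χ χ * A ^ 4 = J' * A' ^ 4)
    (h1 : q % 4 = 1 → jacobiSum χ χ ^ q = jacobiSum χ χ ∧ A ^ q = A ∧ A' ^ q = A')
    (h3 : q % 4 = 3 → jacobiSum χ χ ^ q = J' ∧ A ^ q = A' ∧ A' ^ q = A) (hq : Odd q) :
    χ ((qStar q : ℤ) : ZMod p) = 1 := by
  set J := jacobiSum χ χ with hJ
  set g := gaussSum χ ψ with hg
  have hpK : (p : K) ≠ 0 := by
    intro h
    rw [CharP.cast_eq_zero_iff K q] at h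
    exact hpq ((Nat.prime_dvd_prime_iff_eq Fact.out Fact.out).mp h).symm
  have hcard : (Fintype.card (ZMod p) : K) = p := by rw [ZMod.card]
  have hχ1 : χ ≠ 1 := fun h => h2 (by rw [h, one_pow])
  have hg0 : g ≠ 0 := gaussSum_ne_zero_of_nontrivial (by rwa [hcard]) hχ1 hψ
  have hJ0 : J ≠ 0 := fun h => hpK (by rw [← hJJ', h, zero_mul])
  have hJ'0 : J' ≠ 0 := fun h => hpK (by rw [← hJJ', h, mul_zero])
  have hg4 : g ^ 4 = J ^ 2 * p := by rw [hg, gaussSum_pow_four h4 h2 hψ, hcard]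
  -- This is a fourth root of unity: `g⁴ A'⁴ = J³ J' A'⁴ = J³ · J A⁴ = (J A)⁴`.
  obtain ⟨ζ, hζ⟩ : ∃ ζ, ζ = g * A' / (J * A) := ⟨_, rfl⟩
  have hgζ : g = ζ * (J * A / A') := by
    rw [hζ]; field_simp
  have hζ4 : ζ ^ 4 = 1 := by
    rw [hζ, div_pow, mul_pow, mul_pow, hg4, ← hJJ', div_eq_one_iff_eq (by positivity)]
    linear_combination (-J ^ 3) * hJA
  have hqp : (q : ZMod p) ≠ 0 := by
    intro h
    rw [ZMod.natCast_eq_zero_iff] at h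
    exact hpq ((Nat.prime_dvd_prime_iff_eq Fact.out Fact.out).mp h)
  set u : (ZMod p)ˣ := Units.mk0 _ hqp with hu
  have hfrob : χ (q : ZMod p) ^ q * g ^ q = gaussSum (χ ^ q) ψ := by
    rw [hg, gaussSum_frob, AddChar.pow_mulShift, ← gaussSum_mulShift (χ ^ q) ψ u,
      MulChar.pow_apply' _ (Fact.out : q.Prime).ne_zero]
    rfl
  have hχq4 : χ (q : ZMod p) ^ 4 = 1 := by
    rw [← MulChar.pow_apply' _ four_ne_zero, h4, MulChar.one_apply hqp.isUnit]
  have hq4 : q = 4 * (q / 4) + q % 4 := (Nat.div_add_mod q 4).symm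
  have hmod : q % 4 = 1 ∨ q % 4 = 3 := by
    have := Nat.odd_iff.mp hq
    omega
  rcases hmod with hm | hm
  -- Frobenius fixes `g` and `χ^q = χ`, so `χ(q) = 1`.
  · obtain ⟨e1, e2, e3⟩ := h1 hm
    have hχq : χ ^ q = χ := by
      rw [hq4, hm, pow_add, pow_mul, h4, one_pow, one_mul, pow_one]
    have hpow {x : K} (hx : x ^ 4 = 1) : x ^ q = x := by
      rw [hq4, hm, pow_add, pow_mul, hx, one_pow, one_mul, pow_one]
    have hc := hpow hχq4
    have hgq : g ^ q = g := by
      rw [hgζ, mul_pow, div_pow, mul_pow, e1, e2, e3, hpow hζ4]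
    rw [hc, hχq, hgq] at hfrob
    have : qStar q = (q : ℤ) := by
      have : Even ((q - 1) / 2) := ⟨q / 4, by omega⟩
      rw [qStar, this.neg_one_pow, one_mul]
    rw [this, Int.cast_natCast]
    exact mul_right_cancel₀ hg0 (hfrob.trans (one_mul _).symm)
  -- Frobenius acts as conjugation, so `g^q g = J J' = p`, whereas `g · g(χ⁻¹) = χ(-1) p`. Hence
  -- `χ(q)^q = χ(-1)`, that is `χ(-q) = 1`.
  · obtain ⟨e1, e2, e3⟩ := h3 hm
    have hχq : χ ^ q = χ⁻¹ := by
      rw [eq_inv_iff_mul_eq_one, ← pow_succ]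
      have : q + 1 = 4 * (q / 4 + 1) := by omega
      rw [this, pow_mul, h4, one_pow]
    have hpow {x : K} (hx : x ^ 4 = 1) : x ^ q * x = 1 := by
      rw [← pow_succ]
      have : q + 1 = 4 * (q / 4 + 1) := by omega
      rw [this, pow_mul, hx, one_pow]
    have hc := hpow hχq4
    have hgq : g ^ q * g = p := by
      rw [hgζ, mul_pow, div_pow, mul_pow, e1, e2, e3, ← hJJ']
      field_simp
      linear_combination hpow hζ4
    have hginv : g * gaussSum χ⁻¹ ψ = χ (-1) * p := by
      have := gaussSum_mul_gaussSum_eq_card hχ1 hψ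
      have h' := mul_gaussSum_inv_eq_gaussSum χ⁻¹ ψ
      rw [hcard] at this
      rw [← h', ← this, MulChar.inv_apply']
      simp
      ring
    rw [hχq] at hfrob
    have hst : qStar q = -(q : ℤ) := by
      have : Odd ((q - 1) / 2) := ⟨q / 4, by omega⟩
      rw [qStar, this.neg_one_pow, neg_one_mul]
    have key : χ (q : ZMod p) ^ q = χ (-1) := by
      apply mul_right_cancel₀ hpK
      rw [← hginv, ← hfrob, ← hgq]
      ring
    rw [key] at hc
    rw [hst, Int.cast_neg, Int.cast_natCast, neg_eq_neg_one_mul, map_mul, hc]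

/-- The values of a character of order `n` that equal `1` are taken at `n`-th powers only. -/
theorem MulChar.exists_pow_eq_of_apply_eq_one {F R : Type*} [Field F] [Finite F] [CommRing R]
    (χ : MulChar F R) {a : F} (ha : a ≠ 0) (h : χ a = 1) : ∃ x, x ^ orderOf χ = a := by
  obtain ⟨g, hg⟩ := IsCyclic.exists_generator (α := Fˣ)
  obtain ⟨j, hj⟩ := mem_powers_iff_mem_zpowers.mpr (hg (Units.mk0 a ha))
  have hj' : (g : F) ^ j = a := by
    have := congrArg Units.val hj
    simpa using this
  have hχj : χ ^ j = 1 := by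
    rw [MulChar.eq_iff hg, MulChar.pow_apply_coe, MulChar.one_apply_coe, ← map_pow, hj', h]
  obtain ⟨k, rfl⟩ := orderOf_dvd_of_pow_eq_one hχj
  exact ⟨(g : F) ^ k, by rw [← hj', ← pow_mul, mul_comm]⟩

/-! ### Biquadratic residues from divisors of the quartic form. -/

theorem GaussianInt.isPrimitiveRoot_I : IsPrimitiveRoot (⟨0, 1⟩ : GaussianInt) 4 := by
  rw [IsPrimitiveRoot.iff (by norm_num)]
  refine ⟨by decide, fun l h0 h4 => ?_⟩
  interval_cases l <;> decide

theorem isPrimitiveRoot_four_of_sq {K : Type*} [Field K] {I : K} (hI : I * I = -1)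
    (h2 : (2 : K) ≠ 0) : IsPrimitiveRoot I 4 := by
  have h4 : I ^ 4 = 1 := by linear_combination (I * I - 1) * hI
  have h1 : (-1 : K) ≠ 1 := fun h => h2 (by linear_combination -h)
  rw [IsPrimitiveRoot.iff (by norm_num)]
  refine ⟨h4, fun l h0 hl h => ?_⟩
  have hd : I ^ 2 = 1 := by
    interval_cases l
    · rw [pow_one] at h
      rw [h, one_pow]
    · exact h
    · have : I = 1 := by linear_combination h4 - I * h
      rw [this, one_pow]
  exact h1 (by rw [← hI, ← pow_two, hd])

/-- The form `Im (π (x + i)⁴)` for `π = a + b i`. -/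
def quarticForm (a b x : ℤ) : ℤ := b * (x ^ 4 - 6 * x ^ 2 + 1) + 4 * a * (x ^ 3 - x)

/-- A quartic character modulo `p` with values in the Gaussian integers; its Jacobi sum has norm
`p` and even imaginary part. -/
theorem exists_quarticChar (p : ℕ) [Fact p.Prime] (hp : p % 4 = 1) :
    ∃ χ : MulChar (ZMod p) GaussianInt, orderOf χ = 4 ∧
      (jacobiSum χ χ).re ^ 2 + (jacobiSum χ χ).im ^ 2 = p ∧ Even (jacobiSum χ χ).im := by
  have hd : 4 ∣ Fintype.card (ZMod p) - 1 := by
    rw [ZMod.card]; omega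
  obtain ⟨χ, hχ⟩ := MulChar.exists_mulChar_orderOf (ZMod p) hd GaussianInt.isPrimitiveRoot_I
  have h4 : χ ^ 4 = 1 := hχ ▸ pow_orderOf_eq_one χ
  refine ⟨χ, hχ, ?_, ?_⟩
  · have hinj := GaussianInt.toComplex_injective
    set χ' := χ.ringHomComp GaussianInt.toComplex with hχ'
    have h2 : χ' * χ' ≠ 1 := by
      rw [hχ', ← MulChar.ringHomComp_mul, MulChar.ringHomComp_ne_one_iff hinj, ← pow_two]
      exact pow_ne_one_of_lt_orderOf two_ne_zero (by rw [hχ]; norm_num)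
    have h1 : χ' ≠ 1 := fun h => h2 (by rw [h, one_mul])
    have hch : ringChar ℂ ≠ ringChar (ZMod p) := by
      rw [ringChar.eq_zero, ZMod.ringChar_zmod_n]
      exact (Fact.out : p.Prime).ne_zero.symm
    have h := jacobiSum_mul_jacobiSum_inv hch h1 h1 h2
    have hc : jacobiSum χ'⁻¹ χ'⁻¹ = (starRingEnd ℂ) (jacobiSum χ' χ') := by
      rw [← MulChar.star_eq_inv, ← jacobiSum_ringHomComp]
      rfl
    rw [hc, Complex.mul_conj, hχ', jacobiSum_ringHomComp, ZMod.card,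
      ← GaussianInt.intCast_complex_norm, Zsqrtd.norm_def] at h
    have h' : (jacobiSum χ χ).re * (jacobiSum χ χ).re
      - -1 * (jacobiSum χ χ).im * (jacobiSum χ χ).im = p := by exact_mod_cast h
    linear_combination h'
  -- `J = -1 + z (i - 1)²` and `(i - 1)² = -2i`, so the imaginary part is `-2 Re z`.
  · obtain ⟨z, -, hz⟩ := exists_jacobiSum_eq_neg_one_add (by norm_num) h4 h4 hd
      GaussianInt.isPrimitiveRoot_I
    rw [hz]
    refine ⟨-z.re, ?_⟩
    simp [pow_two]
    ring

/-- For a prime `p ≡ 1 (mod 4)` with `p = a² + b²`, `b` even, every odd prime `q ≠ p` that divides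
a value of the quartic form makes `q*` a biquadratic residue modulo `p`. -/
theorem exists_quarticForm_biquadraticResidue (p : ℕ) [Fact p.Prime] (hp : p % 4 = 1) :
    ∃ a b : ℤ, 0 < a ∧ 0 < b ∧ Even b ∧ a ^ 2 + b ^ 2 = p ∧
      ∀ q : ℕ, q.Prime → Odd q → q ≠ p → ∀ x : ℤ, (q : ℤ) ∣ quarticForm a b x →
        IsBiquadraticResidue (qStar q) p := by
  obtain ⟨χ₀, hord, hnorm, heven⟩ := exists_quarticChar p hp
  have hpp : p.Prime := Fact.out
  have h4 : χ₀ ^ 4 = 1 := hord ▸ pow_orderOf_eq_one χ₀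
  have h2 : χ₀ ^ 2 ≠ 1 := pow_ne_one_of_lt_orderOf two_ne_zero (by rw [hord]; norm_num)
  -- The sign `s = ±1` absorbs the signs of `Re J` and `Im J`, which lets `a` and `b` be taken
  -- positive.
  have main : ∀ q : ℕ, q.Prime → Odd q → q ≠ p → ∀ n s : ℤ, s ^ 2 = 1 →
      (q : ℤ) ∣ (jacobiSum χ₀ χ₀ * (⟨n, s⟩ : GaussianInt) ^ 4).im →
        IsBiquadraticResidue (qStar q) p := by
    intro q hq hodd hqp n s hs hdvd
    have : Fact q.Prime := ⟨hq⟩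
    let K := AlgebraicClosure (ZMod q)
    have : CharP K q := charP_of_injective_algebraMap (algebraMap (ZMod q) K).injective q
    have h2K : (2 : K) ≠ 0 := by
      have := Ring.two_ne_zero (R := K) (by
        rw [ringChar.eq K q]
        rintro rfl
        exact absurd hodd (by decide))
      exact this
    have hpK : (p : K) ≠ 0 := by
      intro h
      rw [CharP.cast_eq_zero_iff K q] at h
      exact hqp ((Nat.prime_dvd_prime_iff_eq hq hpp).mp h)
    have : NeZero (p : K) := ⟨hpK⟩
    obtain ⟨I, hI'⟩ := IsAlgClosed.exists_pow_nat_eq (-1 : K) (n := 2) (by norm_num)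
    have hI : I * I = -1 := by rw [← pow_two, hI']
    have hIroot := isPrimitiveRoot_four_of_sq hI h2K
    let φ : GaussianInt →+* K := Zsqrtd.lift ⟨I, by rw [hI]; simp⟩
    have hφ (z : GaussianInt) : φ z = z.re + z.im * I := rfl
    have hφs (z : GaussianInt) : φ (star z) = z.re - z.im * I := by
      rw [hφ, Zsqrtd.re_star, Zsqrtd.im_star, Int.cast_neg]; ring
    obtain ⟨ζ, hζ⟩ := HasEnoughRootsOfUnity.exists_primitiveRoot K p
    have hψ := AddChar.zmodChar_primitive_of_primitive_root p hζ
    have hIint (m : ℤ) : (m : K) ^ q = m := by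
      have := frobenius_def (R := K) q (m : K)
      rw [← this, map_intCast]
    have hadd (x y : K) : (x + y) ^ q = x ^ q + y ^ q := add_pow_char x y q
    have hf1 (hm : q % 4 = 1) (z : GaussianInt) : φ z ^ q = φ z := by
      have : I ^ q = I := by
        rw [pow_eq_pow_mod q hIroot.pow_eq_one, hm, pow_one]
      rw [hφ, hadd, mul_pow, hIint, hIint, this]
    have hf3 (hm : q % 4 = 3) (z : GaussianInt) : φ z ^ q = φ (star z) := by
      have : I ^ q = -I := by
        rw [pow_eq_pow_mod q hIroot.pow_eq_one, hm]
        linear_combination I * hI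
      rw [hφs, hφ, hadd, mul_pow, hIint, hIint, this]
      ring
    have hJ : jacobiSum (χ₀.ringHomComp φ) (χ₀.ringHomComp φ) = φ (jacobiSum χ₀ χ₀) :=
      jacobiSum_ringHomComp _ _ _
    set J := jacobiSum χ₀ χ₀ with hJdef
    have hJJ : φ J * φ (star J) = p := by
      rw [hφ, hφs]
      have : ((J.re ^ 2 + J.im ^ 2 : ℤ) : K) = (p : ℤ) := by rw [hnorm]
      push_cast at this
      linear_combination this - J.im ^ 2 * hI
    set α : GaussianInt := ⟨n, s⟩ with hα
    have hJα : φ J * φ α ^ 4 = φ (star J) * φ (star α) ^ 4 := by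
      rw [← map_pow, ← map_mul, ← map_pow, ← map_mul, ← star_pow, ← star_mul', hφ, hφs]
      have : (((J * α ^ 4).im : ℤ) : K) = 0 := (CharP.intCast_eq_zero_iff K q _).mpr hdvd
      rw [this]
      ring
    have hsK : (s : K) ^ 2 = 1 := by exact_mod_cast congrArg (Int.cast (R := K)) hs
    -- By `hJα` the two vanish together; then their difference `2 s I` would vanish.
    have hA : φ α ≠ 0 ∧ φ (star α) ≠ 0 := by
      have hJ0 : φ J ≠ 0 := fun h => hpK (by rw [← hJJ, h, zero_mul])
      have hJ'0 : φ (star J) ≠ 0 := fun h => hpK (by rw [← hJJ, h, mul_zero])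
      by_contra hcon
      have hboth : φ α = 0 ∧ φ (star α) = 0 := by
        by_cases h : φ α = 0
        · rw [h] at hJα
          refine ⟨h, ?_⟩
          have : φ (star J) * φ (star α) ^ 4 = 0 := by rw [← hJα]; ring
          simpa [hJ'0] using this
        · have h' : φ (star α) = 0 := by
            by_contra h'
            exact hcon ⟨h, h'⟩
          rw [h'] at hJα
          have : φ J * φ α ^ 4 = 0 := by rw [hJα]; ring
          simp [hJ0, h] at this
      rw [hφ, hφs] at hboth
      have hI0 : (2 : K) * s * I = 0 := by
        linear_combination hboth.1 - hboth.2
      have : (4 : K) = 0 := by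
        linear_combination (-(2 * s * I)) * hI0 + 4 * s ^ 2 * hI - 4 * hsK
      exact h2K (mul_self_eq_zero.mp (by linear_combination this))
    have hχ4 : (χ₀.ringHomComp φ) ^ 4 = 1 := by
      rw [MulChar.ringHomComp_pow, h4, MulChar.ringHomComp_one]
    have hχ2 : (χ₀.ringHomComp φ) ^ 2 ≠ 1 := by
      intro h
      apply h2
      refine MulChar.ext fun a => ?_
      rcases MulChar.isQuadratic_sq h4 a with h0 | h1 | h1
      · exact absurd h0 (a.isUnit.map (χ₀ ^ 2)).ne_zero
      · rw [h1, MulChar.one_apply_coe]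
      · have := congrArg (fun f : MulChar (ZMod p) K => f a) h
        simp only [MulChar.ringHomComp_pow, MulChar.ringHomComp_apply, h1, map_neg, map_one,
          MulChar.one_apply_coe] at this
        exact absurd (by linear_combination -this) h2K
    have hfin := quarticChar_qStar_eq_one (J' := φ (star J)) hqp.symm hχ4 hχ2 hψ hA.1 hA.2
      (by rw [hJ, hJJ]) (by rw [hJ, hJα])
      (fun hm => by rw [hJ]; exact ⟨hf1 hm _, hf1 hm _, hf1 hm _⟩)
      (fun hm => by
        rw [hJ]
        exact ⟨hf3 hm _, hf3 hm _, by rw [hf3 hm, star_star]⟩) hodd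
    have hne : ((qStar q : ℤ) : ZMod p) ≠ 0 := by
      intro h0
      rw [h0, MulChar.map_zero] at hfin
      exact zero_ne_one hfin
    -- `I` has order exactly 4 in `K`, so `φ` is injective on fourth roots of unity and the value 1
    -- lifts to `ℤ[i]`.
    have hχ₀ : χ₀ ((qStar q : ℤ) : ZMod p) = 1 := by
      obtain ⟨k, hk, hk'⟩ := MulChar.exists_apply_eq_pow h4 GaussianInt.isPrimitiveRoot_I hne
      rw [MulChar.ringHomComp_apply, hk', map_pow, hφ] at hfin
      simp only [Int.cast_zero, Int.cast_one, zero_add, one_mul] at hfin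
      have : k = 0 := Nat.eq_zero_of_dvd_of_lt (hIroot.dvd_of_pow_eq_one k hfin) hk
      rw [hk', this, pow_zero]
    obtain ⟨x, hx⟩ := χ₀.exists_pow_eq_of_apply_eq_one hne hχ₀
    rw [hord] at hx
    refine ⟨?_, x.val, ?_⟩
    · rw [Int.isCoprime_iff_gcd_eq_one, Int.gcd_comm, ← Int.isCoprime_iff_gcd_eq_one,
        (Nat.prime_iff_prime_int.mp hpp).irreducible.coprime_iff_not_dvd]
      rwa [Ne, ZMod.intCast_zmod_eq_zero_iff_dvd] at hne
    · rw [← ZMod.intCast_eq_intCast_iff]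
      push_cast
      rw [ZMod.natCast_zmod_val, hx]
  set J := jacobiSum χ₀ χ₀ with hJ
  have hsq (c : ℤ) : c ^ 2 ≠ p := by
    intro h
    have : IsSquare (p : ℤ) := ⟨c, by rw [← h, pow_two]⟩
    exact (Nat.prime_iff_prime_int.mp hpp).irreducible.not_isSquare this
  have hre : J.re ≠ 0 := by
    intro h
    rw [h] at hnorm
    exact hsq J.im (by linear_combination hnorm)
  have him : J.im ≠ 0 := by
    intro h
    rw [h] at hnorm
    exact hsq J.re (by linear_combination hnorm)
  refine ⟨|J.re|, |J.im|, abs_pos.mpr hre, abs_pos.mpr him, even_abs.mpr heven,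
    by rw [sq_abs, sq_abs, hnorm], fun q hq hodd hqp x hdvd => ?_⟩
  have him4 (s : ℤ) (hs : s ^ 2 = 1) : (J * (⟨x, s⟩ : GaussianInt) ^ 4).im =
      J.im * (x ^ 4 - 6 * x ^ 2 + 1) + 4 * (s * J.re) * (x ^ 3 - x) := by
    simp only [pow_succ, pow_zero, one_mul, Zsqrtd.im_mul, Zsqrtd.re_mul]
    linear_combination (J.im * (s ^ 2 + 1 - 6 * x ^ 2) - 4 * J.re * s * x) * hs
  obtain ⟨k, hk⟩ := hdvd
  rcases abs_choice J.re with h | h <;> rcases abs_choice J.im with h' | h' <;>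
    rw [quarticForm, h, h'] at hk
  · exact main q hq hodd hqp x 1 (by norm_num)
      ⟨k, by rw [him4 1 (by norm_num)]; linear_combination hk⟩
  · exact main q hq hodd hqp x (-1) (by norm_num)
      ⟨-k, by rw [him4 (-1) (by norm_num)]; linear_combination -hk⟩
  · exact main q hq hodd hqp x (-1) (by norm_num)
      ⟨k, by rw [him4 (-1) (by norm_num)]; linear_combination hk⟩
  · exact main q hq hodd hqp x 1 (by norm_num)
      ⟨-k, by rw [him4 1 (by norm_num)]; linear_combination -hk⟩

/-! ### Roots of the quartic form modulo prime powers. -/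

/-- The derivative of `Im (π (x + i)⁴)` is `4 Im (π (x + i)³)`. If both vanish modulo `q`, so does
`Re (π (x + i)³)`, hence the norm `p (x² + 1)³`; then `x² ≡ -1` and `b ≡ a x`, which forces `q ∣ a²
+ b² = p`. -/
theorem not_dvd_deriv_of_dvd_quarticForm {a b : ℤ} {p q : ℕ} (hp : p.Prime) (hq : q.Prime)
    (hodd : Odd q) (hqp : q ≠ p) (hab : a ^ 2 + b ^ 2 = p) {x : ℤ}
    (h : (q : ℤ) ∣ quarticForm a b x) :
    ¬ (q : ℤ) ∣ 4 * (b * (x ^ 3 - 3 * x) + a * (3 * x ^ 2 - 1)) := by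
  intro h'
  have hqi : Prime (q : ℤ) := Nat.prime_iff_prime_int.mp hq
  have hq2 : ¬ (q : ℤ) ∣ 2 := by
    intro h2
    have : q ∣ 2 := by exact_mod_cast h2
    rw [(Nat.prime_dvd_prime_iff_eq hq Nat.prime_two).mp this] at hodd
    exact absurd hodd (by decide)
  have hqp' : ¬ (q : ℤ) ∣ p := by
    intro h2
    exact hqp ((Nat.prime_dvd_prime_iff_eq hq hp).mp (by exact_mod_cast h2))
  have hpow (n : ℕ) : ¬ (q : ℤ) ∣ 2 ^ n := fun h2 => hq2 (hqi.dvd_of_dvd_pow h2)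
  have him : (q : ℤ) ∣ b * (x ^ 3 - 3 * x) + a * (3 * x ^ 2 - 1) :=
    (hqi.dvd_or_dvd h').resolve_left (hpow 2)
  have hre : (q : ℤ) ∣ a * (x ^ 3 - 3 * x) - b * (3 * x ^ 2 - 1) := by
    have := dvd_sub h (him.mul_left x)
    refine this.trans (dvd_of_eq ?_)
    rw [quarticForm]
    ring
  have hprod : (q : ℤ) ∣ p * (x ^ 2 + 1) ^ 3 := by
    have := dvd_add (him.mul_left (b * (x ^ 3 - 3 * x) + a * (3 * x ^ 2 - 1)))
      (hre.mul_left (a * (x ^ 3 - 3 * x) - b * (3 * x ^ 2 - 1)))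
    refine this.trans (dvd_of_eq ?_)
    rw [← hab]
    ring
  have hx : (q : ℤ) ∣ x ^ 2 + 1 :=
    hqi.dvd_of_dvd_pow ((hqi.dvd_or_dvd hprod).resolve_left hqp')
  have h8 : (q : ℤ) ∣ 2 ^ 3 * (b - a * x) := by
    have := dvd_sub h (hx.mul_left (b * (x ^ 2 - 7) + 4 * a * x))
    refine this.trans (dvd_of_eq ?_)
    rw [quarticForm]
    ring
  have hbx := (hqi.dvd_or_dvd h8).resolve_left (hpow 3)
  apply hqp'
  have := dvd_add (hbx.mul_left (b + a * x)) (hx.mul_left (a ^ 2))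
  refine this.trans (dvd_of_eq ?_)
  rw [← hab]
  ring

/-- Uniqueness in Hensel's lemma for the quartic form. -/
theorem pow_dvd_sub_of_pow_dvd_quarticForm {a b : ℤ} {p q : ℕ} (hp : p.Prime) (hq : q.Prime)
    (hodd : Odd q) (hqp : q ≠ p) (hab : a ^ 2 + b ^ 2 = p) {x y : ℤ} {k : ℕ} (hk : k ≠ 0)
    (hx : (q : ℤ) ^ k ∣ quarticForm a b x) (hy : (q : ℤ) ^ k ∣ quarticForm a b y)
    (hxy : (q : ℤ) ∣ y - x) : (q : ℤ) ^ k ∣ y - x := by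
  have hqi : Prime (q : ℤ) := Nat.prime_iff_prime_int.mp hq
  have hd := not_dvd_deriv_of_dvd_quarticForm hp hq hodd hqp hab ((dvd_pow_self _ hk).trans hx)
  set D := 4 * (b * (x ^ 3 - 3 * x) + a * (3 * x ^ 2 - 1)) with hD
  set G := b * (6 * x ^ 2 + 4 * x * (y - x) + (y - x) ^ 2 - 6) + 4 * a * (3 * x + (y - x)) with hG
  have hprod : (q : ℤ) ^ k ∣ (y - x) * (D + (y - x) * G) := by
    refine (dvd_sub hy hx).trans (dvd_of_eq ?_)
    rw [quarticForm, quarticForm, hD, hG]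
    ring
  have hcop : IsCoprime ((q : ℤ) ^ k) (D + (y - x) * G) := by
    refine IsCoprime.pow_left ?_
    rw [hqi.irreducible.coprime_iff_not_dvd]
    intro h
    exact hd ((dvd_add_left (hxy.mul_right G)).mp h)
  exact hcop.dvd_of_dvd_mul_right hprod

/-- Replaces the simplicity of roots at the excluded prime `q = p`: only the exponent `k = 1` occurs
there. The norm identity `p (x² + 1)⁴ = R² + f²` drives the descent, with `R` the real part of `π (x
+ i)⁴`. -/
theorem not_sq_dvd_quarticForm {a b : ℤ} {p : ℕ} (hp : p.Prime) (hp2 : p ≠ 2)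
    (hab : a ^ 2 + b ^ 2 = p) (x : ℤ) : ¬ (p : ℤ) ^ 2 ∣ quarticForm a b x := by
  intro h
  have hpi : Prime (p : ℤ) := Nat.prime_iff_prime_int.mp hp
  have hp0 : (p : ℤ) ≠ 0 := hpi.ne_zero
  set f := quarticForm a b x with hf
  set A := x ^ 4 - 6 * x ^ 2 + 1 with hA
  set R := a * A - b * (4 * (x ^ 3 - x)) with hR
  have hnorm : p * (x ^ 2 + 1) ^ 4 = R ^ 2 + f ^ 2 := by
    rw [← hab, hf, hR, hA, quarticForm]
    ring
  have hf4 : (p : ℤ) ^ 4 ∣ f ^ 2 := by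
    have := pow_dvd_pow_of_dvd h 2
    rwa [← pow_mul] at this
  have hpR : (p : ℤ) ∣ R := by
    apply hpi.dvd_of_dvd_pow (n := 2)
    have h1 : (p : ℤ) ∣ f ^ 2 := (dvd_pow_self _ four_ne_zero).trans hf4
    exact (dvd_add_left h1).mp (hnorm ▸ dvd_mul_right _ _)
  have hx : (p : ℤ) ∣ x ^ 2 + 1 := by
    have h1 : (p : ℤ) ^ 2 ∣ p * (x ^ 2 + 1) ^ 4 := by
      rw [hnorm]
      exact dvd_add (pow_dvd_pow_of_dvd hpR 2) ((pow_dvd_pow _ (by norm_num)).trans hf4)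
    rw [pow_two] at h1
    exact hpi.dvd_of_dvd_pow ((mul_dvd_mul_iff_left hp0).mp h1)
  have hpR2 : (p : ℤ) ^ 2 ∣ R := by
    have h1 : (p : ℤ) ^ 4 ∣ R ^ 2 := by
      apply (dvd_add_left hf4).mp
      rw [← hnorm]
      exact (pow_dvd_pow_of_dvd hx 4).mul_left _
    rw [show (4 : ℕ) = 2 * 2 from rfl, pow_mul] at h1
    exact (Int.pow_dvd_pow_iff two_ne_zero).mp h1
  have hpA : (p : ℤ) ∣ A := by
    have h1 : (p : ℤ) ^ 2 ∣ p * A := by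
      have : (p : ℤ) * A = a * R + b * f := by
        rw [← hab, hf, hR, hA, quarticForm]
        ring
      rw [this]
      exact dvd_add (hpR2.mul_left a) (h.mul_left b)
    rw [pow_two] at h1
    exact (mul_dvd_mul_iff_left hp0).mp h1
  have h8 : (p : ℤ) ∣ 2 ^ 3 := by
    have := dvd_sub hpA (hx.mul_left (x ^ 2 - 7))
    refine this.trans (dvd_of_eq ?_)
    rw [hA]
    ring
  have h2 : p ∣ 2 := by exact_mod_cast hpi.dvd_of_dvd_pow h8
  exact hp2 ((Nat.prime_dvd_prime_iff_eq hp Nat.prime_two).mp h2)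

open Polynomial in
theorem card_image_roots_quarticForm_le {a b : ℤ} {p q : ℕ} [Fact q.Prime] (hp : p.Prime)
    (hq2 : q ≠ 2) (hab : a ^ 2 + b ^ 2 = p) (S : Finset (ZMod q))
    (hS : ∀ z ∈ S, (b : ZMod q) * (z ^ 4 - 6 * z ^ 2 + 1) + 4 * a * (z ^ 3 - z) = 0) :
    S.card ≤ 4 := by
  have hq : q.Prime := Fact.out
  set P : (ZMod q)[X] := C (b : ZMod q) * (X ^ 4 - 6 * X ^ 2 + 1) + 4 * C (a : ZMod q) * (X ^ 3 - X)
    with hP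
  have heval (z : ZMod q) : P.eval z = b * (z ^ 4 - 6 * z ^ 2 + 1) + 4 * a * (z ^ 3 - z) := by
    simp [hP]
  have hP0 : P ≠ 0 := by
    intro h
    have h0 : (b : ZMod q) = 0 := by
      have := heval 0
      rw [h] at this
      simpa using this.symm
    have hc : P.coeff 3 = 4 * (a : ZMod q) := by
      have : P = C (4 * (a : ZMod q)) * X ^ 3 - C (4 * (a : ZMod q)) * X := by
        rw [hP, h0, C_mul, C_0, map_ofNat]
        ring
      rw [this, coeff_sub, coeff_C_mul_X_pow, coeff_C_mul_X]
      simp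
    rw [h, coeff_zero] at hc
    have h20 : (2 : ZMod q) ≠ 0 := Ring.two_ne_zero (by rwa [ZMod.ringChar_zmod_n])
    have h40 : (4 : ZMod q) ≠ 0 := by
      rw [show (4 : ZMod q) = 2 * 2 by norm_num]
      exact mul_ne_zero h20 h20
    have ha : (a : ZMod q) = 0 := (mul_eq_zero.mp hc.symm).resolve_left h40
    rw [ZMod.intCast_zmod_eq_zero_iff_dvd] at h0 ha
    have hsq : (q : ℤ) ^ 2 ∣ p := by
      rw [← hab]
      exact dvd_add (pow_dvd_pow_of_dvd ha 2) (pow_dvd_pow_of_dvd h0 2)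
    have hsq' : q * q ∣ p := by
      rw [← pow_two]
      exact_mod_cast hsq
    have := (Nat.squarefree_iff_nodup_primeFactorsList hp.ne_zero).mpr
      (by rw [Nat.primeFactorsList_prime hp]; simp)
    exact hq.one_lt.ne' (Nat.isUnit_iff.mp (this q hsq'))
  have hdeg : P.natDegree ≤ 4 := by
    rw [hP]
    compute_degree
  have hsub : S ⊆ P.roots.toFinset := fun z hz => by
    rw [Multiset.mem_toFinset, mem_roots hP0, IsRoot, heval, hS z hz]
  exact (Finset.card_le_card hsub).trans
    ((Multiset.toFinset_card_le _).trans ((card_roots' P).trans hdeg))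

/-- In a window of length `q ^ k`, at most four terms of the progression `4 m + r` are roots of
the quartic form modulo `q ^ k`. -/
theorem card_window_quarticForm_le {a b : ℤ} {p q : ℕ} (hp : p.Prime) (hp2 : p ≠ 2)
    (hq : q.Prime) (hodd : Odd q) (hab : a ^ 2 + b ^ 2 = p) {k : ℕ} (hk : k ≠ 0) (r : ℤ) (y : ℕ) :
    ((Finset.Ico y (y + q ^ k)).filter
      fun m : ℕ => (q : ℤ) ^ k ∣ quarticForm a b (4 * m + r)).card ≤ 4 := by
  have : Fact q.Prime := ⟨hq⟩
  have hqi : Prime (q : ℤ) := Nat.prime_iff_prime_int.mp hq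
  by_cases hcase : q = p ∧ 2 ≤ k
  · obtain ⟨rfl, h2⟩ := hcase
    rw [Finset.filter_false_of_mem]
    · simp
    · intro m _ h
      exact not_sq_dvd_quarticForm hp hp2 hab _ ((pow_dvd_pow _ h2).trans h)
  have hq2 : q ≠ 2 := by
    rintro rfl
    exact absurd hodd (by decide)
  have hq4 : IsCoprime ((q : ℤ) ^ k) 4 := by
    refine IsCoprime.pow_left ?_
    rw [hqi.irreducible.coprime_iff_not_dvd, show (4 : ℤ) = 2 ^ 2 by norm_num]
    intro h
    have h2 : q ∣ 2 := by exact_mod_cast hqi.dvd_of_dvd_pow h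
    exact hq2 ((Nat.prime_dvd_prime_iff_eq hq Nat.prime_two).mp h2)
  -- Each root modulo `q` lifts to at most one class modulo `q ^ k`, and the window meets each class
  -- once, so reduction modulo `q` is injective here.
  rw [← Finset.card_image_of_injOn (f := fun m : ℕ => (((4 * m + r : ℤ)) : ZMod q))]
  · apply card_image_roots_quarticForm_le hp hq2 hab
    intro z hz
    obtain ⟨m, hm, rfl⟩ := Finset.mem_image.mp hz
    have h := (dvd_pow_self (q : ℤ) hk).trans (Finset.mem_filter.mp hm).2
    rw [← ZMod.intCast_zmod_eq_zero_iff_dvd, quarticForm] at h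
    exact_mod_cast h
  · intro m hm m' hm' heq
    simp only [Finset.coe_filter, Finset.mem_Ico, Set.mem_ofPred_eq] at hm hm'
    have hdvd : (q : ℤ) ∣ (4 * m' + r) - (4 * m + r) := by
      rw [← ZMod.intCast_zmod_eq_zero_iff_dvd, Int.cast_sub, sub_eq_zero]
      exact heq.symm
    have hdvdk : (q : ℤ) ^ k ∣ (4 * m' + r) - (4 * m + r) := by
      by_cases hqp : q = p
      · have : k = 1 := by
          have : ¬ 2 ≤ k := fun h => hcase ⟨hqp, h⟩
          omega
        rwa [this, pow_one]
      · exact pow_dvd_sub_of_pow_dvd_quarticForm hp hq hodd hqp hab hk hm.2 hm'.2 hdvd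
    have h4 : (q : ℤ) ^ k ∣ 4 * ((m' : ℤ) - m) := by
      refine hdvdk.trans (dvd_of_eq ?_)
      ring
    have hfin := hq4.dvd_of_dvd_mul_left h4
    have hlt : |(m' : ℤ) - m| < (q : ℤ) ^ k := by
      have h1 : ((y + q ^ k : ℕ) : ℤ) = y + (q : ℤ) ^ k := by push_cast; ring
      rw [abs_lt]
      omega
    have := Int.eq_zero_of_abs_lt_dvd hfin hlt
    omega

theorem Finset.card_filter_Ico_le_of_window {P : ℕ → Prop} [DecidablePred P] {N C : ℕ}
    (hN : 0 < N) (h : ∀ y, ((Finset.Ico y (y + N)).filter P).card ≤ C) (y U : ℕ) :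
    ((Finset.Ico y (y + U)).filter P).card ≤ C * (U / N + 1) := by
  have key (j : ℕ) : ((Finset.Ico y (y + j * N)).filter P).card ≤ C * j := by
    induction j with
    | zero => simp
    | succ j ih =>
      have : Finset.Ico y (y + (j + 1) * N) =
          Finset.Ico y (y + j * N) ∪ Finset.Ico (y + j * N) (y + j * N + N) := by
        rw [Finset.Ico_union_Ico_eq_Ico (by omega) (by omega)]
        congr 1
        ring
      rw [this, Finset.filter_union, mul_add, mul_one]
      exact (Finset.card_union_le _ _).trans (Nat.add_le_add ih (h _))
  refine le_trans (Finset.card_le_card ?_) (key (U / N + 1))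
  apply Finset.filter_subset_filter
  apply Finset.Ico_subset_Ico_right
  have := Nat.lt_div_mul_add (a := U) hN
  rw [add_mul, one_mul]
  omega

theorem card_Ico_quarticForm_le {a b : ℤ} {p q : ℕ} (hp : p.Prime) (hp2 : p ≠ 2)
    (hq : q.Prime) (hodd : Odd q) (hab : a ^ 2 + b ^ 2 = p) {k : ℕ} (hk : k ≠ 0) (r : ℤ)
    (y U : ℕ) :
    ((Finset.Ico y (y + U)).filter
      fun m : ℕ => (q : ℤ) ^ k ∣ quarticForm a b (4 * m + r)).card ≤ 4 * (U / q ^ k + 1) :=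
  Finset.card_filter_Ico_le_of_window (pow_pos hq.pos k)
    (card_window_quarticForm_le hp hp2 hq hodd hab hk r) y U

/-! ### Bounding a product by its prime factors. -/

/-- On one of the progressions `4 m`, `4 m + 2` the quartic form is never divisible by `16`. -/
theorem exists_not_sixteen_dvd_quarticForm {a b : ℤ} (ha : Odd a) :
    ∃ r : ℕ, r ≤ 2 ∧ ∀ m : ℤ, ¬ (16 : ℤ) ∣ quarticForm a b (4 * m + r) := by
  by_cases hb : (16 : ℤ) ∣ b
  · refine ⟨2, le_rfl, fun m h => ?_⟩
    obtain ⟨c, hc⟩ := ha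
    obtain ⟨d, hd⟩ := hb
    have : quarticForm a b (4 * m + 2) = 16 * (d * ((4 * m + 2) ^ 4 - 6 * (4 * m + 2) ^ 2 + 1) +
        a * (2 * m + 1) * (8 * m ^ 2 + 8 * m + 1) + c * (2 * m + 1) + m) + 8 := by
      rw [quarticForm, hd, hc]
      ring
    push_cast at h
    omega
  · refine ⟨0, by norm_num, fun m h => hb ?_⟩
    have : quarticForm a b (4 * m + 0) =
        b + 16 * (b * (16 * m ^ 4 - 6 * m ^ 2) + a * (16 * m ^ 3 - m)) := by
      rw [quarticForm]
      ring
    push_cast at h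
    omega

theorem Nat.prod_pow_factorization_le {n : ℕ} (hn : n ≠ 0) {T : Finset ℕ}
    (hT : ∀ q ∈ T, q.Prime) : ∏ q ∈ T, q ^ n.factorization q ≤ n := by
  calc ∏ q ∈ T, q ^ n.factorization q
      ≤ ∏ q ∈ T ∪ n.primeFactors, q ^ n.factorization q := by
        refine Finset.prod_le_prod_of_subset_of_one_le' Finset.subset_union_left ?_
        intro q hq _
        rcases Finset.mem_union.mp hq with h | h
        · exact Nat.one_le_pow _ _ (hT q h).pos
        · exact Nat.one_le_pow _ _ (Nat.prime_of_mem_primeFactors h).pos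
    _ = n := by
        conv_rhs => rw [← Nat.prod_factorization_pow_eq_self hn]
        rw [Finsupp.prod_of_support_subset n.factorization
          (s := T ∪ n.primeFactors) Finset.subset_union_right _ (by simp)]

/-- Legendre's formula: the terms `U / q ^ k` add up to at most the exponent of `q` in `U!`, and the
summands `+1` contribute once for each `k ≤ log_q F`. -/
theorem sum_factorization_le {W : Finset ℕ} {g : ℕ → ℕ} {F U q : ℕ} (hq : q.Prime)
    (hpos : ∀ m ∈ W, 0 < g m) (hF : ∀ m ∈ W, g m ≤ F)
    (hcount : ∀ k, k ≠ 0 → (W.filter fun m => q ^ k ∣ g m).card ≤ 4 * (U / q ^ k + 1)) :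
    ∑ m ∈ W, (g m).factorization q ≤ 4 * (U.factorial.factorization q + Nat.log q F) := by
  set L := Nat.log q F with hL
  have hlt (m : ℕ) (hm : m ∈ W) : g m < q ^ (L + 1) :=
    (hF m hm).trans_lt (Nat.lt_pow_succ_log_self hq.one_lt F)
  calc ∑ m ∈ W, (g m).factorization q
      = ∑ m ∈ W, ((Finset.Ico 1 (L + 1)).filter fun i => q ^ i ∣ g m).card :=
        Finset.sum_congr rfl fun m hm =>
          Nat.factorization_eq_card_pow_dvd_of_lt hq (hpos m hm) (hlt m hm)
    _ = ∑ i ∈ Finset.Ico 1 (L + 1), (W.filter fun m => q ^ i ∣ g m).card := by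
        simp_rw [Finset.card_filter]
        exact Finset.sum_comm
    _ ≤ ∑ i ∈ Finset.Ico 1 (L + 1), 4 * (U / q ^ i + 1) := by
        refine Finset.sum_le_sum fun i hi => hcount i ?_
        have := (Finset.mem_Ico.mp hi).1
        omega
    _ = 4 * (∑ i ∈ Finset.Ico 1 (L + 1), U / q ^ i + L) := by
        rw [← Finset.mul_sum, Finset.sum_add_distrib]
        simp
    _ ≤ 4 * (U.factorial.factorization q + L) := by
        gcongr
        -- Legendre's formula needs a cut-off above `log_q U`; enlarging the range only increases
        -- the sum.
        rw [Nat.factorization_factorial hq (b := max (L + 1) (Nat.log q U + 1)) (by omega)]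
        exact Finset.sum_le_sum_of_subset
          (Finset.Ico_subset_Ico_right (le_max_left _ _))

/-- If the terms of a sequence are composed of few primes, each of which divides the terms about
as often as it divides the values of a quartic polynomial, then their product is small. -/
theorem prod_le_of_primeFactors_subset {W T : Finset ℕ} {g : ℕ → ℕ} {F U : ℕ} (hF0 : F ≠ 0)
    (hpos : ∀ m ∈ W, 0 < g m) (hF : ∀ m ∈ W, g m ≤ F) (hT : ∀ q ∈ T, q.Prime) (hT2 : 2 ∉ T)
    (hfac : ∀ m ∈ W, (g m).primeFactors ⊆ insert 2 T) (h16 : ∀ m ∈ W, ¬ 16 ∣ g m)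
    (hcount : ∀ q ∈ T, ∀ k, k ≠ 0 →
      (W.filter fun m => q ^ k ∣ g m).card ≤ 4 * (U / q ^ k + 1)) :
    ∏ m ∈ W, g m ≤ 8 ^ W.card * U.factorial ^ 4 * F ^ (4 * T.card) := by
  have hterm (m : ℕ) (hm : m ∈ W) : g m ≤ 8 * ∏ q ∈ T, q ^ (g m).factorization q := by
    have h0 := (hpos m hm).ne'
    have heq : g m = 2 ^ (g m).factorization 2 * ∏ q ∈ T, q ^ (g m).factorization q := by
      rw [← Finset.prod_insert (f := fun q => q ^ (g m).factorization q) hT2]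
      conv_lhs => rw [← Nat.prod_factorization_pow_eq_self h0]
      rw [Finsupp.prod_of_support_subset _ (hfac m hm) _ (by simp)]
    have h2 : 2 ^ (g m).factorization 2 ≤ 8 := by
      have : (g m).factorization 2 ≤ 3 := by
        by_contra hcon
        exact h16 m hm ((Nat.prime_two.pow_dvd_iff_le_factorization h0 (k := 4)).mpr (by omega))
      calc 2 ^ (g m).factorization 2 ≤ 2 ^ 3 := Nat.pow_le_pow_right (by norm_num) this
        _ = 8 := by norm_num
    calc g m = 2 ^ (g m).factorization 2 * ∏ q ∈ T, q ^ (g m).factorization q := heq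
      _ ≤ _ := Nat.mul_le_mul_right _ h2
  calc ∏ m ∈ W, g m ≤ ∏ m ∈ W, (8 * ∏ q ∈ T, q ^ (g m).factorization q) :=
        Finset.prod_le_prod' hterm
    _ = 8 ^ W.card * ∏ q ∈ T, q ^ ∑ m ∈ W, (g m).factorization q := by
        rw [Finset.prod_mul_distrib, Finset.prod_const, Finset.prod_comm]
        simp_rw [Finset.prod_pow_eq_pow_sum]
    _ ≤ 8 ^ W.card * ∏ q ∈ T, ((q ^ U.factorial.factorization q) ^ 4 * F ^ 4) := by
        gcongr with q hq
        calc q ^ ∑ m ∈ W, (g m).factorization q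
            ≤ q ^ (4 * (U.factorial.factorization q + Nat.log q F)) :=
              Nat.pow_le_pow_right (hT q hq).pos
                (sum_factorization_le (hT q hq) hpos hF (hcount q hq))
          _ = (q ^ U.factorial.factorization q) ^ 4 * (q ^ Nat.log q F) ^ 4 := by
              rw [← pow_mul, ← pow_mul, ← pow_add]
              ring_nf
          _ ≤ (q ^ U.factorial.factorization q) ^ 4 * F ^ 4 := by
              gcongr
              exact Nat.pow_log_le_self q hF0
    _ = 8 ^ W.card * (∏ q ∈ T, q ^ U.factorial.factorization q) ^ 4 * F ^ (4 * T.card) := by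
        rw [Finset.prod_mul_distrib, Finset.prod_const, Finset.prod_pow, ← pow_mul, mul_assoc]
    _ ≤ _ := by
        gcongr
        exact Nat.prod_pow_factorization_le U.factorial_ne_zero hT

/-! ### Size of the quartic form. -/

/-- Only cubic growth holds uniformly, since `b` may be tiny compared with `a`. -/
theorem add_mul_pow_three_le_quarticForm {a b x : ℤ} (ha : 0 < a) (hb : 0 < b) (hx : 4 ≤ x) :
    (a + b) * x ^ 3 ≤ quarticForm a b x := by
  have h3 : 0 ≤ x ^ 3 - x ^ 2 * 4 := by nlinarith [sq_nonneg x]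
  have h1 : 0 ≤ x ^ 4 - 6 * x ^ 2 + 1 - x ^ 3 := by nlinarith [sq_nonneg x, sq_nonneg (x ^ 2)]
  have h2 : 0 ≤ 4 * (x ^ 3 - x) - x ^ 3 := by nlinarith [sq_nonneg x]
  rw [quarticForm]
  nlinarith [mul_nonneg hb.le h1, mul_nonneg ha.le h2]

theorem quarticForm_le_add_mul_pow_four {a b x : ℤ} (ha : 0 < a) (hb : 0 < b) (hx : 4 ≤ x) :
    quarticForm a b x ≤ (a + b) * x ^ 4 := by
  have h1 : 0 ≤ 6 * x ^ 2 - 1 := by nlinarith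
  have h2 : 0 ≤ x ^ 4 - 4 * (x ^ 3 - x) := by
    have : 0 ≤ x ^ 3 * (x - 4) := by
      have : 0 ≤ x := by omega
      have : 0 ≤ x - 4 := by omega
      positivity
    linarith
  rw [quarticForm]
  nlinarith [mul_nonneg hb.le h1, mul_nonneg ha.le h2]

/-! ### Removing the sign when `p ≡ 1 (mod 8)`. -/

/-- Here `i` and `√2` exist modulo `p`, and `((1 + i)/√2)⁴ = -1`. -/
theorem IsBiquadraticResidue.neg {p : ℕ} [Fact p.Prime] (hp : p % 8 = 1) {c : ℤ}
    (h : IsBiquadraticResidue c p) : IsBiquadraticResidue (-c) p := by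
  obtain ⟨hc, x, hx⟩ := h
  have hp2 : p ≠ 2 := by
    rintro rfl
    omega
  obtain ⟨i, hi⟩ := ZMod.exists_sq_eq_neg_one_iff (p := p) |>.mpr (by omega)
  obtain ⟨w, hw⟩ := (ZMod.exists_sq_eq_two_iff hp2).mpr (Or.inl hp)
  have h20 : (2 : ZMod p) ≠ 0 := Ring.two_ne_zero (by rwa [ZMod.ringChar_zmod_n])
  have hw0 : w ≠ 0 := by
    rintro rfl
    exact h20 (by rw [hw, mul_zero])
  have hy : ((1 + i) / w) ^ 4 = -1 := by
    rw [div_pow, div_eq_iff (pow_ne_zero 4 hw0)]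
    have h1 : (1 + i) ^ 4 = -4 := by
      linear_combination (-(i ^ 2 + 4 * i + 5)) * hi
    rw [h1]
    linear_combination (-(w * w + 2)) * hw
  refine ⟨hc.neg_left, x * ((1 + i) / w).val, ?_⟩
  rw [← ZMod.intCast_eq_intCast_iff] at hx ⊢
  push_cast at hx ⊢
  rw [ZMod.natCast_zmod_val, mul_pow, hy, hx]
  ring

theorem isBiquadraticResidue_of_qStar {p q : ℕ} [Fact p.Prime] (hp : p % 8 = 1)
    (h : IsBiquadraticResidue (qStar q) p) : IsBiquadraticResidue (q : ℤ) p := by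
  rw [qStar] at h
  rcases neg_one_pow_eq_or ℤ ((q - 1) / 2) with h1 | h1
  · rwa [h1, one_mul] at h
  · rw [h1] at h
    simpa using h.neg hp

/-! ### Comparison of the two bounds for the product. -/

theorem finite_setOf_cast_lt (B : ℝ) (P : ℕ → Prop) : {q : ℕ | (q : ℝ) < B ∧ P q}.Finite :=
  (Set.finite_le_nat ⌈B⌉₊).subset fun _ hq => Nat.cast_le.mp (hq.1.le.trans (Nat.le_ceil B))

/-- The lower bound for the number of `q` with `q*` a biquadratic residue. -/
theorem rpow_lt_ncard_qStar {ε : ℝ} (hε : 0 < ε) {p : ℕ} [Fact p.Prime] (hp : p % 4 = 1)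
    (hlarge : 8 + 16 * ε < (p : ℝ) ^ (ε / 50)) :
    (p : ℝ) ^ (ε / 50) < (Set.ncard {q : ℕ | q.Prime ∧ Odd q ∧ (q : ℝ) < (p : ℝ) ^ (1 / 2 + ε) ∧
      IsBiquadraticResidue (qStar q) p} : ℝ) := by
  have hpp : p.Prime := Fact.out
  have hp2 : p ≠ 2 := by
    rintro rfl
    omega
  have hpodd : Odd p := hpp.odd_of_ne_two hp2
  have hp1 : (1 : ℝ) < p := by exact_mod_cast hpp.one_lt
  have hp0 : (0 : ℝ) ≤ p := by positivity
  obtain ⟨a, b, ha, hb, hbeven, hab, hres⟩ := exists_quarticForm_biquadraticResidue p hp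
  have haodd : Odd a := by
    have h : Odd (a ^ 2 + b ^ 2) := by rw [hab]; exact_mod_cast hpodd
    have h2 : Even (b ^ 2) := hbeven.pow_of_ne_zero two_ne_zero
    exact (Int.odd_pow' two_ne_zero).mp ((Int.odd_add.mp h).mpr h2)
  obtain ⟨r, hr, h16⟩ := exists_not_sixteen_dvd_quarticForm (b := b) haodd
  by_contra! hcon
  set S := {q : ℕ | q.Prime ∧ Odd q ∧ (q : ℝ) < (p : ℝ) ^ (1 / 2 + ε) ∧
    IsBiquadraticResidue (qStar q) p} with hS
  have hSfin : S.Finite := (finite_setOf_cast_lt ((p : ℝ) ^ (1 / 2 + ε)) fun _ => True).subset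
    fun q hq => ⟨hq.2.2.1, trivial⟩
  set t : ℝ := (p : ℝ) ^ (ε / 50) with ht
  have ht8 : 8 < t := by linarith
  have htpow (n : ℕ) : t ^ n = (p : ℝ) ^ (ε / 50 * n) := by
    rw [ht, ← Real.rpow_natCast, ← Real.rpow_mul hp0]
  set U := ⌊t ^ 5⌋₊ with hU
  have hUle : (U : ℝ) ≤ t ^ 5 := Nat.floor_le (by positivity)
  have hUlt : t ^ 5 < U + 1 := Nat.lt_floor_add_one _
  have hU1 : 1 ≤ U := by
    refine Nat.le_floor ?_
    rw [Nat.cast_one]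
    exact one_le_pow₀ (by linarith)
  -- Starting at `2 U²` gives `8 U² ≤ x ≤ 14 U²`: then `x³ ≥ 512 U⁶` outweighs `8 U⁴`, while `x⁴` is
  -- `O(t⁴⁰)`, leaving `t¹⁰` of `p^ε = t⁵⁰` for constants.
  set W := Finset.Ico (2 * U ^ 2) (2 * U ^ 2 + U) with hW
  have hWcard : W.card = U := by simp [hW]
  set f : ℕ → ℤ := fun m => quarticForm a b (4 * m + r) with hf
  set g : ℕ → ℕ := fun m => (f m).toNat with hg
  have hab_lower : (p : ℝ) ^ (1 / 2 : ℝ) ≤ (a + b : ℤ) := by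
    rw [← Real.sqrt_eq_rpow, Real.sqrt_le_left (by exact_mod_cast (add_pos ha hb).le)]
    have : (p : ℤ) ≤ (a + b) ^ 2 := by nlinarith [mul_pos ha hb]
    exact_mod_cast this
  have hab_upper : ((a + b : ℤ) : ℝ) ≤ 2 * (p : ℝ) ^ (1 / 2 : ℝ) := by
    have h1 : ((a + b : ℤ) : ℝ) ^ 2 ≤ 4 * p := by
      have : (a + b) ^ 2 ≤ 4 * (p : ℤ) := by nlinarith [sq_nonneg (a - b)]
      exact_mod_cast this
    rw [← Real.sqrt_eq_rpow]
    apply le_of_sq_le_sq _ (by positivity)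
    rw [mul_pow, Real.sq_sqrt hp0]
    linarith
  have hx (m : ℕ) (hm : m ∈ W) : 8 * U ^ 2 ≤ 4 * m + r ∧ 4 * m + r ≤ 14 * U ^ 2 := by
    rw [hW, Finset.mem_Ico] at hm
    have : U ≤ U ^ 2 := Nat.le_self_pow two_ne_zero U
    omega
  have hx4 (m : ℕ) (hm : m ∈ W) : (4 : ℤ) ≤ 4 * m + r := by
    have h1 := (hx m hm).1
    have h2 : 1 ≤ U ^ 2 := Nat.one_le_pow _ _ hU1
    omega
  have hflower (m : ℕ) (hm : m ∈ W) : (a + b) * (4 * m + r : ℤ) ^ 3 ≤ f m :=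
    add_mul_pow_three_le_quarticForm ha hb (hx4 m hm)
  have hfpos (m : ℕ) (hm : m ∈ W) : 0 < f m := by
    have h1 := hx4 m hm
    exact lt_of_lt_of_le (by positivity) (hflower m hm)
  have hgf (m : ℕ) (hm : m ∈ W) : (g m : ℤ) = f m := Int.toNat_of_nonneg (hfpos m hm).le
  have hglower (m : ℕ) (hm : m ∈ W) : (p : ℝ) ^ (1 / 2 : ℝ) * (512 * U ^ 6) ≤ g m := by
    have h1 : (512 * U ^ 6 : ℝ) ≤ ((4 * m + r : ℤ) : ℝ) ^ 3 := by
      calc (512 * U ^ 6 : ℝ) = ((8 * U ^ 2 : ℕ) : ℝ) ^ 3 := by push_cast; ring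
        _ ≤ ((4 * m + r : ℕ) : ℝ) ^ 3 := by gcongr; exact (hx m hm).1
        _ = _ := by push_cast; ring
    calc (p : ℝ) ^ (1 / 2 : ℝ) * (512 * U ^ 6)
        ≤ ((a + b : ℤ) : ℝ) * ((4 * m + r : ℤ) : ℝ) ^ 3 := by gcongr
      _ = (((a + b) * (4 * m + r : ℤ) ^ 3 : ℤ) : ℝ) := by push_cast; ring
      _ ≤ ((g m : ℤ) : ℝ) := by rw [hgf m hm]; exact_mod_cast hflower m hm
      _ = g m := by simp
  have hgupper (m : ℕ) (hm : m ∈ W) : (g m : ℝ) < (p : ℝ) ^ (1 / 2 + ε) := by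
    have h1 : ((4 * m + r : ℤ) : ℝ) ^ 4 ≤ 14 ^ 4 * t ^ 40 := by
      calc ((4 * m + r : ℤ) : ℝ) ^ 4 = ((4 * m + r : ℕ) : ℝ) ^ 4 := by push_cast; ring
        _ ≤ ((14 * U ^ 2 : ℕ) : ℝ) ^ 4 := by gcongr; exact (hx m hm).2
        _ = 14 ^ 4 * (U : ℝ) ^ 8 := by push_cast; ring
        _ ≤ 14 ^ 4 * (t ^ 5) ^ 8 := by gcongr
        _ = 14 ^ 4 * t ^ 40 := by ring
    have hx0 : (0 : ℝ) ≤ ((4 * m + r : ℤ) : ℝ) ^ 4 := by positivity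
    have h10 : (2 * 14 ^ 4 : ℝ) < t ^ 10 :=
      calc (2 * 14 ^ 4 : ℝ) < 8 ^ 10 := by norm_num
        _ ≤ t ^ 10 := by gcongr
    have hsqrt : 0 < (p : ℝ) ^ (1 / 2 : ℝ) := by positivity
    calc (g m : ℝ) = ((g m : ℤ) : ℝ) := by simp
      _ ≤ (((a + b) * (4 * m + r : ℤ) ^ 4 : ℤ) : ℝ) := by
          rw [hgf m hm]
          exact_mod_cast quarticForm_le_add_mul_pow_four ha hb (hx4 m hm)
      _ = ((a + b : ℤ) : ℝ) * ((4 * m + r : ℤ) : ℝ) ^ 4 := by push_cast; ring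
      _ ≤ (2 * (p : ℝ) ^ (1 / 2 : ℝ)) * (14 ^ 4 * t ^ 40) := by gcongr
      _ = (p : ℝ) ^ (1 / 2 : ℝ) * t ^ 40 * (2 * 14 ^ 4) := by ring
      _ < (p : ℝ) ^ (1 / 2 : ℝ) * t ^ 40 * t ^ 10 := by gcongr
      _ = (p : ℝ) ^ (1 / 2 : ℝ) * t ^ 50 := by ring
      _ = (p : ℝ) ^ (1 / 2 + ε) := by
          rw [htpow, ← Real.rpow_add (by linarith)]
          congr 2
          push_cast
          ring
  -- The prime `p` may divide values of the form but yields no residue, so it is added by hand.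
  set T := insert p hSfin.toFinset with hT
  have hTprime (q : ℕ) (hq : q ∈ T) : q.Prime ∧ Odd q := by
    rcases Finset.mem_insert.mp hq with rfl | h
    · exact ⟨hpp, hpodd⟩
    · rw [Set.Finite.mem_toFinset] at h
      exact ⟨h.1, h.2.1⟩
  have hTcard : (T.card : ℝ) ≤ t + 1 := by
    have h1 : T.card ≤ S.ncard + 1 := by
      rw [Set.ncard_eq_toFinset_card S hSfin]
      exact Finset.card_insert_le _ _
    calc (T.card : ℝ) ≤ ((S.ncard + 1 : ℕ) : ℝ) := by exact_mod_cast h1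
      _ ≤ t + 1 := by push_cast; linarith
  have hFlt : ((W.sup g : ℕ) : ℝ) < (p : ℝ) ^ (1 / 2 + ε) := by
    obtain ⟨m, hm, hsup⟩ := Finset.exists_mem_eq_sup W
      (Finset.card_pos.mp (by rw [hWcard]; exact hU1)) g
    rw [hsup]
    exact hgupper m hm
  have hF0 : W.sup g ≠ 0 := by
    obtain ⟨m, hm⟩ := Finset.card_pos.mp (hWcard ▸ hU1 : 0 < W.card)
    have h1 : 0 < (g m : ℤ) := by rw [hgf m hm]; exact hfpos m hm
    have h2 : g m ≤ W.sup g := Finset.le_sup hm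
    omega
  have hprod := prod_le_of_primeFactors_subset (W := W) (T := T) (g := g) (F := W.sup g) (U := U)
    hF0
    (fun m hm => by exact_mod_cast (hgf m hm).symm ▸ hfpos m hm)
    (fun m hm => Finset.le_sup hm) (fun q hq => (hTprime q hq).1)
    (fun h => absurd (hTprime 2 h).2 (by decide))
    (fun m hm q hq => by
      have hqp := Nat.prime_of_mem_primeFactors hq
      have hdvd := Nat.dvd_of_mem_primeFactors hq
      have h0 : 0 < g m := by exact_mod_cast (hgf m hm).symm ▸ hfpos m hm
      rw [hT, Finset.mem_insert, Finset.mem_insert, Set.Finite.mem_toFinset]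
      by_cases hq2 : q = 2
      · exact Or.inl hq2
      by_cases hqeq : q = p
      · exact Or.inr (Or.inl hqeq)
      refine Or.inr (Or.inr ⟨hqp, hqp.odd_of_ne_two hq2, ?_, ?_⟩)
      · exact lt_of_le_of_lt (by exact_mod_cast Nat.le_of_dvd h0 hdvd) (hgupper m hm)
      · refine hres q hqp (hqp.odd_of_ne_two hq2) hqeq (4 * m + r) ?_
        have h' : (q : ℤ) ∣ (g m : ℤ) := by exact_mod_cast hdvd
        rwa [hgf m hm] at h')
    (fun m hm h => h16 m (by
      have h' : (16 : ℤ) ∣ (g m : ℤ) := by exact_mod_cast h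
      rwa [hgf m hm] at h'))
    (fun q hq k hk => by
      refine le_trans (Finset.card_le_card ?_)
        (card_Ico_quarticForm_le hpp hp2 (hTprime q hq).1 (hTprime q hq).2 hab hk r (2 * U ^ 2) U)
      intro m hm
      rw [Finset.mem_filter] at hm ⊢
      refine ⟨hm.1, ?_⟩
      have h' : (q : ℤ) ^ k ∣ (g m : ℤ) := by exact_mod_cast hm.2
      rwa [hgf m hm.1] at h')
  rw [hWcard] at hprod
  have hprod' : (∏ m ∈ W, (g m : ℝ)) ≤
      8 ^ U * (U.factorial : ℝ) ^ 4 * ((W.sup g : ℕ) : ℝ) ^ (4 * T.card) := by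
    exact_mod_cast hprod
  have hlow : ((p : ℝ) ^ (1 / 2 : ℝ) * (512 * U ^ 6)) ^ U ≤ ∏ m ∈ W, (g m : ℝ) := by
    rw [← hWcard, ← Finset.prod_const]
    rw [hWcard]
    exact Finset.prod_le_prod (fun m _ => by positivity) hglower
  have hfact : (8 : ℝ) ^ U * (U.factorial : ℝ) ^ 4 ≤ (512 * (U : ℝ) ^ 6) ^ U := by
    have hU1' : (1 : ℝ) ≤ U := by exact_mod_cast hU1
    calc (8 : ℝ) ^ U * (U.factorial : ℝ) ^ 4 ≤ 8 ^ U * ((U : ℝ) ^ U) ^ 4 := by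
          gcongr
          exact_mod_cast Nat.factorial_le_pow U
      _ = (8 * (U : ℝ) ^ 4) ^ U := by rw [mul_pow, ← pow_mul, ← pow_mul, mul_comm U 4]
      _ ≤ (512 * (U : ℝ) ^ 6) ^ U := by
          gcongr
          · norm_num
          · norm_num
  have hpos512 : (0 : ℝ) < (512 * (U : ℝ) ^ 6) ^ U := by
    have : (0 : ℝ) < U := by exact_mod_cast hU1
    positivity
  have hkey : ((p : ℝ) ^ (1 / 2 : ℝ)) ^ U ≤ ((p : ℝ) ^ (1 / 2 + ε)) ^ (4 * T.card) := by
    refine le_of_mul_le_mul_right ?_ hpos512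
    calc ((p : ℝ) ^ (1 / 2 : ℝ)) ^ U * (512 * (U : ℝ) ^ 6) ^ U
        = ((p : ℝ) ^ (1 / 2 : ℝ) * (512 * U ^ 6)) ^ U := (mul_pow _ _ _).symm
      _ ≤ 8 ^ U * (U.factorial : ℝ) ^ 4 * ((W.sup g : ℕ) : ℝ) ^ (4 * T.card) :=
          hlow.trans hprod'
      _ ≤ (512 * (U : ℝ) ^ 6) ^ U * ((p : ℝ) ^ (1 / 2 + ε)) ^ (4 * T.card) := by gcongr
      _ = _ := mul_comm _ _
  rw [← Real.rpow_natCast, ← Real.rpow_natCast, ← Real.rpow_mul hp0, ← Real.rpow_mul hp0,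
    Real.rpow_le_rpow_left_iff hp1] at hkey
  push_cast at hkey
  -- Comparing exponents of `p`: `U/2 ≤ (1/2 + ε) · 4|T|`.
  have hle : (U : ℝ) ≤ (4 + 8 * ε) * (t + 1) := by
    have : (4 + 8 * ε) * (T.card : ℝ) ≤ (4 + 8 * ε) * (t + 1) := by gcongr
    linarith
  have h2 : (4 + 8 * ε) * (t + 1) ≤ t ^ 2 := by nlinarith
  have h5 : t ^ 2 + 1 ≤ t ^ 5 := by
    have h1 : 8 ≤ t ^ 3 := by
      calc (8 : ℝ) ≤ 8 ^ 3 := by norm_num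
        _ ≤ t ^ 3 := by gcongr
    nlinarith [sq_nonneg t]
  linarith

theorem theorem2 (ε : ℝ) (hε : 0 < ε) :
    ∃ p₀ : ℝ, ∀ p : ℕ, p.Prime → p % 4 = 1 → p₀ < (p : ℝ) →
      (p : ℝ) ^ (ε / 50) <
          (Set.ncard {q : ℕ | q.Prime ∧ Odd q ∧ (q : ℝ) < (p : ℝ) ^ (1 / 2 + ε) ∧
            IsBiquadraticResidue (qStar q) p} : ℝ) ∧
        (p % 8 = 1 →
          (p : ℝ) ^ (ε / 50) <
            (Set.ncard {q : ℕ | q.Prime ∧ (q : ℝ) < (p : ℝ) ^ (1 / 2 + ε) ∧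
              IsBiquadraticResidue (q : ℤ) p} : ℝ)) := by
  -- Chosen so that `8 + 16ε < p^(ε/50) = t`, which gives `(4 + 8ε)(t + 1) ≤ t²`.
  refine ⟨(8 + 16 * ε) ^ (50 / ε), fun p hp h4 hlt => ?_⟩
  have : Fact p.Prime := ⟨hp⟩
  have hlarge : 8 + 16 * ε < (p : ℝ) ^ (ε / 50) := by
    have h := Real.rpow_lt_rpow (by positivity) hlt (by positivity : 0 < ε / 50)
    rwa [← Real.rpow_mul (by positivity), show 50 / ε * (ε / 50) = 1 by field_simp,
      Real.rpow_one] at h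
  have hmain := rpow_lt_ncard_qStar hε h4 hlarge
  refine ⟨hmain, fun h8 => hmain.trans_le ?_⟩
  rw [Nat.cast_le]
  refine Set.ncard_le_ncard (fun q hq => ⟨hq.1, hq.2.2.1, isBiquadraticResidue_of_qStar h8 hq.2.2.2⟩)
    ((finite_setOf_cast_lt ((p : ℝ) ^ (1 / 2 + ε)) fun _ => True).subset
      fun q hq => ⟨hq.2.1, trivial⟩)
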